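/- Let $\mathbb F$ be an algebraically closed field of characteristic $0$, let $n\ge 1$, and let $\Gamma$ be an additive subgroup of $\mathbb F^n$ that is nondegenerate, i.e. contains an $\mathbb F$-basis of $\mathbb F^n$. Let $\mathcal W(\Gamma,n)$ be the Lie algebra with basis $t^\alpha D^\mu=t^\alpha D_1^{\mu_1}\cdots D_n^{\mu_n}$ ($\alpha\in\Gamma$, $\mu\in\mathbb Z_{\ge 0}^n$), whose bracket is the commutator of the associative product $$(t^\alpha D^\mu)\cdot(t^\beta D^\nu)=\sum_{\lambda\le\mu}\Bigl(\prod_{i=1}^n\binom{\mu_i}{\lambda_i}\beta_i^{\lambda_i}\Bigr)\,t^{\alpha+\beta}D^{\mu+\nu-\lambda},$$ and let $\mathcal W(\Gamma,n)_\alpha$ be the span of the elements $t^\alpha D^\mu$, $\mu\in\mathbb Z_{\ge0}^n$. Write $t^\alpha$ for $t^\alpha D^0$. Let $V$ be a uniformly bounded $\mathcal W(\Gamma,n)$-module, i.e. a module with a grading $V=\bigoplus_{\alpha\in\Gamma}V_\alpha$ such that $\mathcal W(\Gamma,n)_\alpha V_\beta\subseteq V_{\alpha+\beta}$ for all $\alpha,\beta\in\Gamma$,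 every $V_\alpha$ is finite-dimensional, and $\dim V_\alpha\le N$ for all $\alpha\in\Gamma$ and some positive integer $N$. Say that $V$ has a trivial composition factor if there are graded submodules $M'\subseteq M$ of $V$ such that $M/M'$ is irreducible and $\mathcal W(\Gamma,n)$ acts on $M/M'$ by zero. **Proposition 3.2.** Suppose that $\Gamma$ is not isomorphic to $\mathbb Z$ and that $V$ has no trivial composition factor. Then $t^\alpha\cdot v\neq 0$ for every $\alpha\in\Gamma\setminus\{0\}$ and every $v\in V\setminus\{0\}$. -/

import Mathlib

open MvPolynomial

noncomputable section

/-- The vector space `F[Γ] ⊗ F[D₁, …, Dₙ]` of generalized differential operators, for an additive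
subgroup `Γ` of `Fⁿ`.  An element `∑ α, t^α p_α(D)` is stored as the finitely supported family
`α ↦ p_α` of polynomials in `D₁, …, Dₙ`.  The same space carries the associative algebra `𝒜(Γ,n)`
and, under the commutator bracket, the Lie algebra `𝒲(Γ,n)`. -/
def WeylType {F : Type*} [Field F] {n : ℕ} (Γ : AddSubgroup (Fin n → F)) : Type _ :=
  Γ →₀ MvPolynomial (Fin n) F

namespace WeylType

variable {F : Type*} [Field F] {n : ℕ} {Γ : AddSubgroup (Fin n → F)}

instance : AddCommGroup (WeylType Γ) :=
  inferInstanceAs (AddCommGroup (Γ →₀ MvPolynomial (Fin n) F))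

instance : Module F (WeylType Γ) :=
  inferInstanceAs (Module F (Γ →₀ MvPolynomial (Fin n) F))

/-- The operator `t^α p(D)`. -/
def single (α : Γ) (p : MvPolynomial (Fin n) F) : WeylType Γ := Finsupp.single α p

/-- The basis element `t^α D^μ`. -/
def tD (α : Γ) (μ : Fin n →₀ ℕ) : WeylType Γ := single α (monomial μ 1)

/-- The element `t^α = t^α D^0`. -/
def t (α : Γ) : WeylType Γ := tD α 0

/-- The substitution `p(D) ↦ p(D + β)`, that is, `D_i ↦ D_i + β_i`.  It describes how a polynomial
in the degree operators is moved past `t^β`: `p(D) t^β = t^β p(D + β)`. -/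
def shift (β : Fin n → F) : MvPolynomial (Fin n) F →ₐ[F] MvPolynomial (Fin n) F :=
  aeval fun i => X i + C (β i)

/-- The associative product: `(t^α p(D)) · (t^β q(D)) = t^(α+β) p(D+β) q(D)`, extended bilinearly.
On basis elements this is the binomial formula `tD_mul_tD` below. -/
def mul (f g : WeylType Γ) : WeylType Γ :=
  Finsupp.sum f fun α p => Finsupp.sum g fun β q =>
    single (α + β) (shift (β : Fin n → F) p * q)

instance : Mul (WeylType Γ) := ⟨mul⟩

instance : One (WeylType Γ) := ⟨single 0 1⟩

theorem one_def : (1 : WeylType Γ) = single 0 1 := rfl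

theorem single_zero (α : Γ) : single α (0 : MvPolynomial (Fin n) F) = 0 :=
  Finsupp.single_zero α

theorem single_add (α : Γ) (p q : MvPolynomial (Fin n) F) :
    single α (p + q) = single α p + single α q :=
  Finsupp.single_add α p q

theorem smul_single (c : F) (α : Γ) (p : MvPolynomial (Fin n) F) :
    c • single α p = single α (c • p) :=
  Finsupp.smul_single c α p

theorem induction {P : WeylType Γ → Prop} (f : WeylType Γ) (h0 : P 0)
    (hs : ∀ α p, P (single α p)) (ha : ∀ f g, P f → P g → P (f + g)) : P f :=
  Finsupp.induction_linear f h0 ha hs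

theorem shift_zero (p : MvPolynomial (Fin n) F) : shift (0 : Fin n → F) p = p := by
  have : shift (0 : Fin n → F) = AlgHom.id F _ := by
    ext i; simp [shift]
  rw [this]; rfl

theorem shift_shift (β γ : Fin n → F) (p : MvPolynomial (Fin n) F) :
    shift γ (shift β p) = shift (β + γ) p := by
  have : (shift γ).comp (shift β) = shift (β + γ) := by
    ext i; simp [shift, add_comm, add_left_comm]
  rw [← this]; rfl

theorem single_mul_single (α β : Γ) (p q : MvPolynomial (Fin n) F) :
    single α p * single β q = single (α + β) (shift (β : Fin n → F) p * q) := by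
  change mul _ _ = _
  unfold mul
  refine (Finsupp.sum_single_index ?_).trans (Finsupp.sum_single_index ?_)
  · refine (Finsupp.sum_single_index ?_).trans ?_ <;> simp [single_zero]
  · simp [single_zero]

theorem zero_mul' (f : WeylType Γ) : 0 * f = 0 := by
  change mul _ _ = _
  unfold mul
  exact Finsupp.sum_zero_index

theorem mul_zero' (f : WeylType Γ) : f * 0 = 0 := by
  change mul _ _ = _
  unfold mul
  exact (Finset.sum_congr rfl fun _ _ => Finsupp.sum_zero_index).trans Finset.sum_const_zero

theorem add_mul' (f g h : WeylType Γ) : (f + g) * h = f * h + g * h := by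
  classical
  change mul _ _ = mul _ _ + mul _ _
  unfold mul
  refine Finsupp.sum_add_index' (fun α => ?_) (fun α p q => ?_)
  · simp [single_zero, Finsupp.sum]
  · simp [add_mul, single_add, Finsupp.sum, Finset.sum_add_distrib]

theorem mul_add' (f g h : WeylType Γ) : f * (g + h) = f * g + f * h := by
  classical
  change mul _ _ = mul _ _ + mul _ _
  unfold mul
  refine Eq.trans (Finset.sum_congr rfl fun α _ => ?_) Finset.sum_add_distrib
  refine Finsupp.sum_add_index' (fun β => ?_) (fun β p q => ?_)
  · simp [single_zero]
  · simp [mul_add, single_add]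

theorem mul_assoc' (f g h : WeylType Γ) : f * g * h = f * (g * h) := by
  induction f using WeylType.induction with
  | h0 => simp only [zero_mul']
  | ha f₁ f₂ h₁ h₂ => simp only [add_mul', h₁, h₂]
  | hs α p =>
    induction g using WeylType.induction with
    | h0 => simp only [zero_mul', mul_zero']
    | ha f₁ f₂ h₁ h₂ => simp only [add_mul', mul_add', h₁, h₂]
    | hs β q =>
      induction h using WeylType.induction with
      | h0 => simp only [mul_zero']
      | ha f₁ f₂ h₁ h₂ => simp only [mul_add', h₁, h₂]
      | hs γ r =>
        simp only [single_mul_single, map_mul, shift_shift, add_assoc, mul_assoc,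
          AddSubgroup.coe_add]

theorem one_mul' (f : WeylType Γ) : 1 * f = f := by
  induction f using WeylType.induction with
  | h0 => exact mul_zero' _
  | ha f₁ f₂ h₁ h₂ => rw [mul_add', h₁, h₂]
  | hs α p => simp [one_def, single_mul_single]

theorem mul_one' (f : WeylType Γ) : f * 1 = f := by
  induction f using WeylType.induction with
  | h0 => exact zero_mul' _
  | ha f₁ f₂ h₁ h₂ => rw [add_mul', h₁, h₂]
  | hs α p => simp [one_def, single_mul_single, shift_zero]

theorem smul_mul' (c : F) (f g : WeylType Γ) : c • f * g = c • (f * g) := by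
  induction f using WeylType.induction with
  | h0 => simp only [smul_zero, zero_mul']
  | ha f₁ f₂ h₁ h₂ => simp only [smul_add, add_mul', h₁, h₂]
  | hs α p =>
    induction g using WeylType.induction with
    | h0 => simp only [smul_zero, mul_zero']
    | ha f₁ f₂ h₁ h₂ => simp only [smul_add, mul_add', h₁, h₂]
    | hs β q => simp only [smul_single, single_mul_single, map_smul, smul_mul_assoc]

theorem mul_smul' (c : F) (f g : WeylType Γ) : f * c • g = c • (f * g) := by
  induction f using WeylType.induction with
  | h0 => simp only [smul_zero, zero_mul']
  | ha f₁ f₂ h₁ h₂ => simp only [smul_add, add_mul', h₁, h₂]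
  | hs α p =>
    induction g using WeylType.induction with
    | h0 => simp only [smul_zero, mul_zero']
    | ha f₁ f₂ h₁ h₂ => simp only [smul_add, mul_add', h₁, h₂]
    | hs β q => simp only [smul_single, single_mul_single, mul_smul_comm]

/-- The associative algebra `𝒜(Γ,n)`. -/
instance : Ring (WeylType Γ) :=
  { (inferInstance : AddCommGroup (WeylType Γ)) with
    mul := (· * ·)
    one := 1
    zero_mul := zero_mul'
    mul_zero := mul_zero'
    left_distrib := mul_add'
    right_distrib := add_mul'
    mul_assoc := mul_assoc'
    one_mul := one_mul'
    mul_one := mul_one' }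

instance : Algebra F (WeylType Γ) :=
  Algebra.ofModule smul_mul' mul_smul'

/-- The Lie algebra `𝒲(Γ,n)`: the bracket is the commutator `⁅x, y⁆ = x * y - y * x`. -/
instance : LieRing (WeylType Γ) := LieRing.ofAssociativeRing

instance : LieAlgebra F (WeylType Γ) := LieAlgebra.ofAssociativeAlgebra

theorem lie_def (x y : WeylType Γ) : ⁅x, y⁆ = x * y - y * x := rfl

/-- The product of basis elements:
`(t^α D^μ)(t^β D^ν) = ∑ λ, (μ choose λ) β^λ t^(α+β) D^(μ+ν-λ)`, the sum running over the
multi-indices `λ ≤ μ` (the binomial coefficient vanishes for the others). -/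
theorem tD_mul_tD (α β : Γ) (μ ν : Fin n →₀ ℕ) :
    tD α μ * tD β ν = ∑ l ∈ Fintype.piFinset fun i => Finset.range (μ i + 1),
      (∏ i, ((μ i).choose (l i) : F) * (β : Fin n → F) i ^ l i) •
        tD (α + β) (μ + ν - Finsupp.equivFunOnFinite.symm l) := by
  have key : shift (β : Fin n → F) (monomial μ 1) * monomial ν 1 =
      ∑ l ∈ Fintype.piFinset fun i => Finset.range (μ i + 1),
        (∏ i, ((μ i).choose (l i) : F) * (β : Fin n → F) i ^ l i) •
          monomial (μ + ν - Finsupp.equivFunOnFinite.symm l) (1 : F) := by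
    have h1 : shift (β : Fin n → F) (monomial μ 1) =
        ∏ i, ∑ k ∈ Finset.range (μ i + 1),
          C (((μ i).choose k : F) * (β : Fin n → F) i ^ k) * X i ^ (μ i - k) := by
      rw [shift, aeval_monomial, map_one, one_mul, Finsupp.prod_fintype _ _ (fun i => pow_zero _)]
      refine Finset.prod_congr rfl fun i _ => ?_
      rw [add_comm, add_pow]
      refine Finset.sum_congr rfl fun k _ => ?_
      simp only [map_mul, map_pow, map_natCast]
      ring
    rw [h1, Finset.prod_univ_sum, Finset.sum_mul]
    refine Finset.sum_congr rfl fun l hl => ?_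
    have hl' : ∀ i, l i ≤ μ i := fun i => by
      have := Fintype.mem_piFinset.1 hl i
      simpa [Nat.lt_succ_iff] using this
    have h2 : μ + ν - Finsupp.equivFunOnFinite.symm l =
        (μ - Finsupp.equivFunOnFinite.symm l) + ν := by
      ext i
      have := hl' i
      simp
      omega
    have h3 : ∏ i, (X i : MvPolynomial (Fin n) F) ^ (μ i - l i) =
        monomial (μ - Finsupp.equivFunOnFinite.symm l) 1 := by
      rw [monomial_eq, Finsupp.prod_fintype _ _ (fun i => pow_zero _)]
      simp
    rw [Finset.prod_mul_distrib, h3, h2, ← map_prod, mul_assoc, monomial_mul, mul_one,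
      smul_eq_C_mul]
  have hlin : ∀ (s : Finset (Fin n → ℕ)) (a : (Fin n → ℕ) → MvPolynomial (Fin n) F),
      single (α + β) (∑ l ∈ s, a l) = ∑ l ∈ s, single (α + β) (a l) :=
    fun s a => map_sum (Finsupp.singleAddHom (α + β)) a s
  rw [tD, tD, single_mul_single, key, hlin]
  simp only [tD, smul_single]

/-- The grading space `𝒲(Γ,n)_α`, spanned by the `t^α D^μ`. -/
def gradingSpace (α : Γ) : Submodule F (WeylType Γ) :=
  Submodule.span F (Set.range fun μ : Fin n →₀ ℕ => tD α μ)

end WeylType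

section Modules

variable {F : Type*} [Field F] {n : ℕ} {Γ : AddSubgroup (Fin n → F)}
  {V : Type*} [AddCommGroup V] [Module F V]
  [LieRingModule (WeylType Γ) V] [LieModule F (WeylType Γ) V]

open Classical in
/-- `V = ⊕_{α ∈ Γ} V_α`, with the given family of grading spaces, is a quasifinite
`𝒲(Γ,n)`-module. -/
structure IsQuasifinite (𝒱 : Γ → Submodule F V) : Prop where
  isInternal : DirectSum.IsInternal 𝒱
  lie_mem : ∀ α β : Γ, ∀ x ∈ WeylType.gradingSpace α, ∀ v ∈ 𝒱 β, ⁅x, v⁆ ∈ 𝒱 (α + β)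
  finiteDimensional : ∀ α, FiniteDimensional F (𝒱 α)

/-- `V = ⊕_{α ∈ Γ} V_α` is a uniformly bounded `𝒲(Γ,n)`-module. -/
structure IsUniformlyBounded (𝒱 : Γ → Submodule F V) : Prop extends IsQuasifinite 𝒱 where
  bounded : ∃ N : ℕ, 0 < N ∧ ∀ α, Module.finrank F (𝒱 α) ≤ N

/-- A submodule is graded when it is the sum of its intersections with the grading spaces. -/
def IsGradedSubmodule (𝒱 : Γ → Submodule F V) (M : LieSubmodule F (WeylType Γ) V) : Prop :=
  M.toSubmodule = ⨆ α, M.toSubmodule ⊓ 𝒱 α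

/-- `V` has a trivial composition factor: there are graded submodules `N ⊆ M` of `V` such that
`M / N` is irreducible and `𝒲(Γ,n)` acts on it trivially. -/
def HasTrivialCompositionFactor (𝒱 : Γ → Submodule F V) : Prop :=
  ∃ N M : LieSubmodule F (WeylType Γ) V, N ≤ M ∧
    IsGradedSubmodule 𝒱 N ∧ IsGradedSubmodule 𝒱 M ∧
    LieModule.IsIrreducible F (WeylType Γ) (M ⧸ N.comap M.incl) ∧
    LieModule.IsTrivial (WeylType Γ) (M ⧸ N.comap M.incl)

end Modules

end

/-! Suppose `t^α` kills a nonzero vector; passing to components, the vector may be taken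
homogeneous. With `α_j ≠ 0` and `L = D_j / α_j`, the relation `[L, t^α] = t^α` shows that `L`
preserves the kernel of `t^α` in that degree, so the kernel contains an eigenvector `u` of `L`. It
is shown that all of `𝒲(Γ,n)` kills `u`, so that `u` spans a trivial composition factor.

The vector `u` lies in a graded family `U` on which `t^α` is locally nilpotent and `L` has a single
generalized eigenvalue in each degree (`isBoundedFamily_inf`). An `sl₂`-triple containing `t^α`
forces `U` to vanish in suitable degrees arbitrarily far along `α`: otherwise, highest weight
vectors from infinitely many degrees, lowered to one degree, would be independent there
(`IsBoundedFamily.exists_eq_bot`).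

For `ν ≠ 0` the polynomials `p` with `t^ν p(D) U_β = 0` form an ideal. By the Nullstellensatz it is
everything unless it has a zero. A zero would propagate, thanks to the vanishing of `U`, to more
zeros in one degree than the dimension bound permits (`IsBoundedFamily.annihilatorZeros_eq_empty`).
So every nonzero degree acts on `U` by zero, and brackets then give degree `0`. -/

open MvPolynomial

noncomputable section

/-! ### Difference operators, brackets and the `sl₂`-triple -/

namespace WeylType

variable {F : Type*} [Field F] {n : ℕ} {Γ : AddSubgroup (Fin n → F)}

theorem shift_X (β : Fin n → F) (i : Fin n) :
    shift β (X i : MvPolynomial (Fin n) F) = X i + C (β i) := by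
  simp [shift]

theorem shift_C (β : Fin n → F) (c : F) : shift β (C c) = (C c : MvPolynomial (Fin n) F) :=
  (shift β).commutes c

theorem eval_shift (β x : Fin n → F) (p : MvPolynomial (Fin n) F) :
    eval x (shift β p) = eval (x + β) p := by
  have : (aeval x).comp (shift β) = (aeval (x + β) : MvPolynomial (Fin n) F →ₐ[F] F) := by
    ext i; simp [shift]
  simpa [aeval_eq_eval] using DFunLike.congr_fun this p

/-- The linear polynomial `D_j / α_j`. -/
def height (α : Fin n → F) (j : Fin n) : MvPolynomial (Fin n) F := C (α j)⁻¹ * X j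

theorem shift_height (α β : Fin n → F) (j : Fin n) :
    shift β (height α j) = height α j + C ((α j)⁻¹ * β j) := by
  simp only [height, map_mul, shift_C, shift_X]
  ring

theorem shift_height_self {α : Fin n → F} {j : Fin n} (hj : α j ≠ 0) :
    shift α (height α j) = height α j + 1 := by
  rw [shift_height, inv_mul_cancel₀ hj, map_one]

/-- The difference operator `p(D) ↦ p(D + β) - p(D)`. -/
def diff (β : Fin n → F) : Module.End F (MvPolynomial (Fin n) F) := (shift β).toLinearMap - 1

theorem diff_apply (β : Fin n → F) (p : MvPolynomial (Fin n) F) :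
    diff β p = shift β p - p := rfl

/-- Discrete integration in direction `β`: falling factorials in `D_j / β_j` play the role of
powers, and the shift-invariant polynomials `X i - β_i L` play the role of constants. -/
theorem diff_surjective [CharZero F] {β : Fin n → F} (hβ : β ≠ 0) :
    Function.Surjective (diff β) := by
  obtain ⟨j, hj⟩ := Function.ne_iff.1 hβ
  set L := height β j with hL
  have hs : shift β L = L + 1 := shift_height_self hj
  -- The falling factorial `L (L - 1) ⋯ (L - m + 1)`, whose difference is `m` times the previous
  -- one.
  let d : ℕ → MvPolynomial (Fin n) F := fun m => ∏ i ∈ Finset.range m, (L - C (i : F))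
  have hd : ∀ m, d (m + 1) = d m * (L - C (m : F)) := fun m => Finset.prod_range_succ _ _
  have hsd : ∀ m, shift β (d (m + 1)) = (L + 1) * d m := by
    intro m
    simp only [d, map_prod, map_sub, shift_C, hs]
    rw [Finset.prod_range_succ']
    rw [mul_comm]
    congr 1
    · simp
    · refine Finset.prod_congr rfl fun i _ => ?_
      simp
  have hdiff : ∀ m, diff β (d (m + 1)) = ((m : F) + 1) • d m := by
    intro m
    rw [diff_apply, hsd, hd, smul_eq_C_mul]
    simp only [map_add, map_one]
    ring
  let R : Submodule F (MvPolynomial (Fin n) F) := LinearMap.range (diff β)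
  have key : ∀ p : MvPolynomial (Fin n) F, ∀ m, p * d m ∈ R := by
    intro p
    induction p using MvPolynomial.induction_on with
    | C c =>
      intro m
      refine ⟨(c * ((m : F) + 1)⁻¹) • d (m + 1), ?_⟩
      rw [map_smul, hdiff, smul_smul, mul_assoc, inv_mul_cancel₀ (Nat.cast_add_one_ne_zero m),
        mul_one, smul_eq_C_mul]
    | add p q hp hq => intro m; rw [add_mul]; exact R.add_mem (hp m) (hq m)
    | mul_X p i hp =>
      intro m
      -- Split `X i` into its shift-invariant part and `β_i L`, then use `L * d m = d (m + 1) + m *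
      -- d m`.
      have h1 : (p * X i * d m : MvPolynomial (Fin n) F) =
          (X i - C (β i) * L) * (p * d m) + (β i) • (p * d (m + 1)) +
            (β i * m) • (p * d m) := by
        rw [hd, smul_eq_C_mul, smul_eq_C_mul, C_mul]
        ring
      rw [h1]
      refine R.add_mem (R.add_mem ?_ (R.smul_mem _ (hp _))) (R.smul_mem _ (hp _))
      obtain ⟨q, hq⟩ := hp m
      refine ⟨(X i - C (β i) * L) * q, ?_⟩
      have h2 : shift β (X i - C (β i) * L) = X i - C (β i) * L := by
        rw [map_sub, map_mul, shift_C, shift_X, hs]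
        ring
      rw [← hq, diff_apply, diff_apply, map_mul, h2]
      ring
  intro p
  have h : p * d 0 ∈ R := key p 0
  rwa [show d 0 = 1 from rfl, mul_one] at h

/-- Taking differences lowers the degree of a polynomial. -/
theorem exists_diff_pow_eq_zero (β : Fin n → F) (p : MvPolynomial (Fin n) F) :
    ∃ k, (diff β ^ k) p = 0 := by
  induction p using MvPolynomial.induction_on with
  | C c => exact ⟨1, by rw [pow_one, diff_apply, shift_C, sub_self]⟩
  | add p q hp hq =>
    obtain ⟨k, hk⟩ := hp
    obtain ⟨l, hl⟩ := hq
    refine ⟨k + l, ?_⟩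
    rw [map_add, Module.End.pow_map_zero_of_le (Nat.le_add_right k l) hk,
      Module.End.pow_map_zero_of_le (Nat.le_add_left l k) hl, add_zero]
  | mul_X p i hp =>
    obtain ⟨k, hk⟩ := hp
    refine ⟨k + 1, ?_⟩
    induction k generalizing p with
    | zero =>
      have hp0 : p = 0 := hk
      rw [hp0, zero_mul, map_zero]
    | succ k ih =>
      have h1 : diff β (p * X i) = diff β p * X i + β i • (p + diff β p) := by
        rw [diff_apply, diff_apply, map_mul, shift_X, smul_eq_C_mul]
        ring
      have hk' : (diff β ^ k) (diff β p) = 0 := by rw [← hk, pow_succ]; rfl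
      have h2 : (diff β ^ (k + 1)) (diff β p) = 0 :=
        Module.End.pow_map_zero_of_le (Nat.le_succ k) hk'
      have h3 : (diff β ^ (k + 1 + 1)) (p * X i) = (diff β ^ (k + 1)) (diff β (p * X i)) := by
        rw [pow_succ]; rfl
      rw [h3, h1, map_add, ih _ hk', map_smul, map_add, hk, h2, add_zero, smul_zero, add_zero]

theorem lie_single_single (α β : Γ) (p q : MvPolynomial (Fin n) F) :
    ⁅single α p, single β q⁆ =
      single (α + β) (shift (β : Fin n → F) p * q - shift (α : Fin n → F) q * p) := by
  rw [lie_def, single_mul_single, single_mul_single, add_comm β α]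
  exact (Finsupp.single_sub _ _ _).symm

theorem t_eq_single (α : Γ) : t α = single α 1 := rfl

theorem single_injective (α : Γ) :
    Function.Injective (single α : MvPolynomial (Fin n) F → WeylType Γ) :=
  Finsupp.single_injective α

theorem lie_t_single (α β : Γ) (p : MvPolynomial (Fin n) F) :
    ⁅t α, single β p⁆ = single (α + β) (-diff (α : Fin n → F) p) := by
  rw [t_eq_single, lie_single_single, diff_apply, map_one, one_mul, mul_one, neg_sub]

theorem single_mem_gradingSpace (α : Γ) (p : MvPolynomial (Fin n) F) :
    single α p ∈ gradingSpace α := by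
  induction p using MvPolynomial.induction_on' with
  | monomial u a =>
    have : single α (monomial u a) = a • tD α u := by
      rw [tD, smul_single, smul_monomial, smul_eq_mul, mul_one]
    rw [this]
    exact Submodule.smul_mem _ _ (Submodule.subset_span ⟨u, rfl⟩)
  | add p q hp hq => rw [single_add]; exact Submodule.add_mem _ hp hq

/-- Since `ad t^α` is locally nilpotent, the vectors of a module on which `t^α` is nilpotent form a
submodule. -/
theorem mem_maxGenEigenspace_t (α : Γ) (x : WeylType Γ) :
    x ∈ (LieModule.toEnd F (WeylType Γ) (WeylType Γ) (t α)).maxGenEigenspace 0 := by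
  induction x using WeylType.induction with
  | h0 => exact Submodule.zero_mem _
  | ha f g hf hg => exact Submodule.add_mem _ hf hg
  | hs β p =>
    obtain ⟨k, hk⟩ := exists_diff_pow_eq_zero (α : Fin n → F) p
    rw [Module.End.mem_maxGenEigenspace]
    refine ⟨k, ?_⟩
    rw [zero_smul, sub_zero]
    induction k generalizing β p with
    | zero =>
      have hp : p = 0 := hk
      rw [hp, single_zero, map_zero]
    | succ k ih =>
      have h1 : (diff (α : Fin n → F) ^ k) (-diff (α : Fin n → F) p) = 0 := by
        rw [map_neg, neg_eq_zero, ← hk, pow_succ]; rfl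
      rw [pow_succ]
      change ((LieModule.toEnd F (WeylType Γ) (WeylType Γ) (t α)) ^ k) ⁅t α, single β p⁆ = 0
      rw [lie_t_single]
      exact ih _ _ h1

theorem lie_height_single (α γ : Γ) (j : Fin n) (p : MvPolynomial (Fin n) F) :
    ⁅single (0 : Γ) (height (α : Fin n → F) j), single γ p⁆ =
      (((α : Fin n → F) j)⁻¹ * (γ : Fin n → F) j) • single γ p := by
  rw [lie_single_single, zero_add, shift_height, AddSubgroup.coe_zero, shift_zero, smul_single,
    smul_eq_C_mul]
  congr 1
  ring

/-- For `L = D_j / α_j`, the elements `2L`, `t^α`, `t^(-α) (L - L²)` form an `sl₂`-triple. -/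
theorem isSl2Triple_height [CharZero F] (α : Γ) {j : Fin n} (hj : (α : Fin n → F) j ≠ 0) :
    IsSl2Triple ((2 : F) • single (0 : Γ) (height (α : Fin n → F) j)) (t α)
      (single (-α) (height (α : Fin n → F) j - height (α : Fin n → F) j ^ 2)) := by
  set L := height (α : Fin n → F) j with hL
  have hs : shift (α : Fin n → F) L = L + 1 := shift_height_self hj
  refine ⟨?_, ?_, ?_, ?_⟩
  · intro h
    have h0 : single (0 : Γ) L = single 0 0 :=
      ((smul_eq_zero.1 h).resolve_left two_ne_zero).trans (single_zero 0).symm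
    have h1 : L + 1 = 0 := by rw [← hs, single_injective 0 h0, map_zero]
    exact one_ne_zero (by rw [← h1, single_injective 0 h0, zero_add] :
      (1 : MvPolynomial (Fin n) F) = 0)
  · rw [lie_t_single, add_neg_cancel, diff_apply, smul_single, two_smul]
    congr 1
    simp only [map_sub, map_pow, hs]
    ring
  · rw [smul_lie, t_eq_single, lie_height_single, inv_mul_cancel₀ hj, one_smul, two_smul,
      two_nsmul]
  · rw [smul_lie, lie_height_single, AddSubgroup.coe_neg, Pi.neg_apply, mul_neg,
      inv_mul_cancel₀ hj, neg_one_smul, smul_neg, two_smul, two_nsmul]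

end WeylType

/-! ### Bounded families and the zeros of their annihilators -/

namespace WeylType

variable {F : Type*} [Field F] {n : ℕ} {Γ : AddSubgroup (Fin n → F)}
  {V : Type*} [AddCommGroup V] [Module F V]
  [LieRingModule (WeylType Γ) V] [LieModule F (WeylType Γ) V]

/-- A family of subspaces of dimension at most `N`, shifted by the action of `𝒲(Γ,n)` as the
grading spaces of a graded module are. -/
structure IsBoundedFamily (U : Γ → Submodule F V) (N : ℕ) : Prop where
  lie_mem : ∀ (α β : Γ) (p : MvPolynomial (Fin n) F), ∀ v ∈ U β, ⁅single α p, v⁆ ∈ U (α + β)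
  finiteDimensional : ∀ β, FiniteDimensional F (U β)
  finrank_le : ∀ β, Module.finrank F (U β) ≤ N

/-- The polynomials `p` for which `t^α p(D)` annihilates `U_β`. -/
def annihilator (U : Γ → Submodule F V) (α β : Γ) : Submodule F (MvPolynomial (Fin n) F) where
  carrier := {p | ∀ v ∈ U β, ⁅single α p, v⁆ = 0}
  add_mem' hp hq v hv := by rw [single_add, add_lie, hp v hv, hq v hv, add_zero]
  zero_mem' v _ := by rw [single_zero, zero_lie]
  smul_mem' c p hp v hv := by rw [← smul_single, smul_lie, hp v hv, smul_zero]

theorem mem_annihilator {U : Γ → Submodule F V} {α β : Γ} {p : MvPolynomial (Fin n) F} :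
    p ∈ annihilator U α β ↔ ∀ v ∈ U β, ⁅single α p, v⁆ = 0 := Iff.rfl

/-- The common zeros of the polynomials `p` for which `t^α p(D)` annihilates `U_β`. -/
def annihilatorZeros (U : Γ → Submodule F V) (α β : Γ) : Set (Fin n → F) :=
  {x | ∀ p ∈ annihilator U α β, eval x p = 0}

variable {U : Γ → Submodule F V} {N : ℕ}

/-- Bracketing `t^α p` with a degree-zero `q(D)` multiplies `p` by a difference of `q`, up to sign.
For `α ≠ 0` every polynomial is such a difference, so the annihilator is an ideal. -/
theorem IsBoundedFamily.mul_mem_annihilator [CharZero F] (hU : IsBoundedFamily U N)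
    {α : Γ} (hα : α ≠ 0) (β : Γ) (r : MvPolynomial (Fin n) F) {p : MvPolynomial (Fin n) F}
    (hp : p ∈ annihilator U α β) : r * p ∈ annihilator U α β := by
  obtain ⟨q, hq⟩ := diff_surjective (β := (α : Fin n → F)) (by simpa using hα) r
  intro v hv
  have h1 : single α (r * p) = ⁅single α p, single (0 : Γ) (-q)⁆ := by
    rw [lie_single_single, add_zero, AddSubgroup.coe_zero, shift_zero, ← hq, diff_apply, map_neg]
    congr 1
    ring
  have h2 : ⁅single (0 : Γ) (-q), v⁆ ∈ U β := by
    have := hU.lie_mem 0 β (-q) v hv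
    rwa [zero_add] at this
  rw [h1, lie_lie, hp _ h2, hp v hv, lie_zero, sub_zero]

theorem IsBoundedFamily.annihilator_eq_top [IsAlgClosed F] [CharZero F]
    (hU : IsBoundedFamily U N) {α : Γ} (hα : α ≠ 0) {β : Γ}
    (h : annihilatorZeros U α β = ∅) : annihilator U α β = ⊤ := by
  let I : Ideal (MvPolynomial (Fin n) F) :=
    { (annihilator U α β).toAddSubmonoid with
      smul_mem' := fun r p hp => hU.mul_mem_annihilator hα β r hp }
  have hI : ∀ p, p ∈ I ↔ p ∈ annihilator U α β := fun p => Iff.rfl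
  have htop : I = ⊤ := by
    by_contra hne
    obtain ⟨m, hm, hIm⟩ := Ideal.exists_le_maximal I hne
    obtain ⟨x, rfl⟩ := (isMaximal_iff_eq_vanishingIdeal_singleton (K := F)).1 hm
    have hx : x ∈ annihilatorZeros U α β := by
      intro p hp
      have := hIm ((hI p).2 hp)
      simpa [aeval_eq_eval] using (mem_vanishingIdeal_singleton_iff x p).1 this
    rw [h] at hx
    exact hx
  ext p
  simp [← hI, htop]

/-- If `t^α` maps `U_β` to zero for degree reasons, then the common zeros in degree `α + μ` and
their translates by `μ` are common zeros in degree `α`. -/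
theorem IsBoundedFamily.mem_annihilatorZeros (hU : IsBoundedFamily U N)
    {α β : Γ} (μ : Γ) (hα : α ≠ 0) (hαβ : U (α + β) = ⊥) {x : Fin n → F}
    (hx : x ∈ annihilatorZeros U (α + μ) β) :
    x ∈ annihilatorZeros U α (μ + β) ∧ x + (μ : Fin n → F) ∈ annihilatorZeros U α (μ + β) := by
  have key : ∀ p ∈ annihilator U α (μ + β),
      eval x p = 0 ∧ eval (x + (μ : Fin n → F)) p = 0 := by
    intro p hp
    -- Both terms of the commutator of `t^α p` and `t^μ q` vanish on `U_β`: one since `p`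
    -- annihilates `U_(μ+β)`, the other since `U_(α+β) = 0`.
    have hr : ∀ q : MvPolynomial (Fin n) F,
        shift (μ : Fin n → F) p * q - shift (α : Fin n → F) q * p ∈ annihilator U (α + μ) β := by
      intro q v hv
      have h0 : ⁅single α p, v⁆ = 0 := by
        have := hU.lie_mem α β p v hv
        rwa [hαβ, Submodule.mem_bot] at this
      rw [← lie_single_single, lie_lie, h0, lie_zero, hp _ (hU.lie_mem μ β q v hv), sub_zero]
    have he : ∀ q : MvPolynomial (Fin n) F,
        eval (x + (μ : Fin n → F)) p * eval x q - eval (x + (α : Fin n → F)) q * eval x p = 0 := by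
      intro q
      have := hx _ (hr q)
      rwa [map_sub, map_mul, map_mul, eval_shift, eval_shift] at this
    obtain ⟨j, hj⟩ := Function.ne_iff.1 (show (α : Fin n → F) ≠ 0 by simpa using hα)
    -- Taking `q = 1` gives `p(x + μ) = p(x)`. Taking `q = X_j - x_j`, which vanishes at `x` but not
    -- at `x + α`, gives `p(x) = 0`.
    have h1 := he 1
    have h2 := he (X j - C (x j))
    simp only [map_sub, map_one, eval_X, eval_C, sub_self, mul_zero, Pi.add_apply,
      add_sub_cancel_left, zero_sub, neg_eq_zero, mul_eq_zero, one_mul, mul_one] at h1 h2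
    have h3 : eval x p = 0 := h2.resolve_left hj
    exact ⟨h3, by rwa [h3, sub_zero] at h1⟩
  exact ⟨fun p hp => (key p hp).1, fun p hp => (key p hp).2⟩

/-- Polynomials in `D_j` of degree at most `N²` form a space of dimension `N² + 1`, while the maps
`U_β → U_(α+β)` form one of dimension at most `N²`. Some nonzero one therefore annihilates `U_β`,
and it has too few roots for `N² + 1` distinct `j`-th coordinates. -/
theorem IsBoundedFamily.not_injective_of_annihilatorZeros (hU : IsBoundedFamily U N)
    {α β : Γ} (x : Fin (N * N + 1) → Fin n → F) (hx : ∀ i, x i ∈ annihilatorZeros U α β)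
    (j : Fin n) : ¬ Function.Injective fun i => x i j := by
  intro hinj
  have := hU.finiteDimensional β
  have := hU.finiteDimensional (α + β)
  let Φ : MvPolynomial (Fin n) F →ₗ[F] (U β →ₗ[F] U (α + β)) :=
    { toFun := fun p => (LieModule.toEnd F (WeylType Γ) V (single α p)).restrict
        (hU.lie_mem α β p)
      map_add' := fun p q => LinearMap.ext fun v => Subtype.ext <| by
        change ⁅single α (p + q), (v : V)⁆ = ⁅single α p, (v : V)⁆ + ⁅single α q, (v : V)⁆
        rw [single_add, add_lie]
      map_smul' := fun c p => LinearMap.ext fun v => Subtype.ext <| by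
        change ⁅single α (c • p), (v : V)⁆ = c • ⁅single α p, (v : V)⁆
        rw [← smul_single, smul_lie] }
  let Ψ : Polynomial.degreeLT F (N * N + 1) →ₗ[F] (U β →ₗ[F] U (α + β)) :=
    Φ ∘ₗ (Polynomial.aeval (X j : MvPolynomial (Fin n) F)).toLinearMap ∘ₗ Submodule.subtype _
  have : FiniteDimensional F (Polynomial.degreeLT F (N * N + 1)) :=
    Module.Finite.equiv (Polynomial.degreeLTEquiv F (N * N + 1)).symm
  have hlt : Module.finrank F (U β →ₗ[F] U (α + β)) <
      Module.finrank F (Polynomial.degreeLT F (N * N + 1)) := by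
    rw [Module.finrank_linearMap, (Polynomial.degreeLTEquiv F (N * N + 1)).finrank_eq,
      Module.finrank_fin_fun]
    exact Nat.lt_succ_of_le (Nat.mul_le_mul (hU.finrank_le _) (hU.finrank_le _))
  obtain ⟨g, hg, hg0⟩ := (Submodule.ne_bot_iff _).1 (LinearMap.ker_ne_bot_of_finrank_lt hlt (f := Ψ))
  have hmem : Polynomial.aeval (X j : MvPolynomial (Fin n) F) (g : Polynomial F) ∈
      annihilator U α β := by
    intro v hv
    exact congrArg Subtype.val (LinearMap.congr_fun hg ⟨v, hv⟩)
  have hroot : ∀ i, (g : Polynomial F).eval (x i j) = 0 := by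
    intro i
    have h1 := hx i _ hmem
    have h2 : eval (x i) (Polynomial.aeval (X j : MvPolynomial (Fin n) F) (g : Polynomial F)) =
        (g : Polynomial F).eval (x i j) := by
      rw [← coe_aeval_eq_eval]
      change aeval (x i) _ = _
      rw [← Polynomial.aeval_algHom_apply, aeval_X, Polynomial.coe_aeval_eq_eval]
    rwa [h2] at h1
  refine hg0 (Subtype.ext ?_)
  refine Polynomial.eq_zero_of_degree_lt_of_eval_index_eq_zero (s := Finset.univ)
    (v := fun i => x i j) hinj.injOn ?_ fun i _ => hroot i
  simpa using Polynomial.mem_degreeLT.1 g.2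

end WeylType

/-! ### Vanishing along `α` by `sl₂`-theory -/

/-- In a linear relation, the power of `e` given by the largest index with nonzero coefficient
isolates that term. -/
theorem linearIndependent_of_pow_apply_eq_zero {F V : Type*} [Field F] [AddCommGroup V]
    [Module F V] (e : Module.End F V) (T : Finset ℕ) (w : T → V)
    (h1 : ∀ i : T, (e ^ (i : ℕ)) (w i) ≠ 0) (h2 : ∀ i : T, (e ^ ((i : ℕ) + 1)) (w i) = 0) :
    LinearIndependent F w := by
  classical
  rw [Fintype.linearIndependent_iff]
  intro c hc
  by_contra! hne
  obtain ⟨i₀, hi₀⟩ := hne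
  obtain ⟨m, hm, hmax⟩ := Finset.exists_max_image (Finset.univ.filter fun i => c i ≠ 0)
    (fun i => (i : ℕ)) ⟨i₀, by simpa using hi₀⟩
  have hcm : c m ≠ 0 := by simpa using hm
  have hsum : (e ^ (m : ℕ)) (∑ i, c i • w i) = c m • (e ^ (m : ℕ)) (w m) := by
    rw [map_sum]
    refine (Finset.sum_eq_single m (fun i _ him => ?_) (by simp)).trans (map_smul _ _ _)
    rw [map_smul]
    by_cases hci : c i = 0
    · rw [hci, zero_smul]
    · have hle : (i : ℕ) ≤ m := hmax i (by simpa using hci)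
      have hlt : (i : ℕ) + 1 ≤ m :=
        Nat.lt_of_le_of_ne hle fun h => him (Subtype.ext h)
      rw [Module.End.pow_map_zero_of_le hlt (h2 i), smul_zero]
  rw [hc, map_zero] at hsum
  exact (smul_ne_zero hcm (h1 m)) hsum.symm

/-- The scalar is the product of `(i + 1)(μ - i)` over `i < k`. -/
theorem IsSl2Triple.HasPrimitiveVectorWith.exists_e_pow_f_pow {R L M : Type*} [Field R]
    [CharZero R] [LieRing L] [LieAlgebra R L] [AddCommGroup M] [Module R M] [LieRingModule L M]
    [LieModule R L M] {h e f : L} {ht : IsSl2Triple h e f} {m : M} {μ : R}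
    (P : ht.HasPrimitiveVectorWith m μ) (k : ℕ) (hμ : ∀ i < k, μ ≠ i) :
    ∃ c : R, c ≠ 0 ∧
      (LieModule.toEnd R L M e ^ k) ((LieModule.toEnd R L M f ^ k) m) = c • m := by
  induction k with
  | zero => exact ⟨1, one_ne_zero, by simp⟩
  | succ k ih =>
    obtain ⟨c, hc, h⟩ := ih fun i hi => hμ i (Nat.lt_succ_of_lt hi)
    refine ⟨(((k : R) + 1) * (μ - k)) * c,
      mul_ne_zero (mul_ne_zero (Nat.cast_add_one_ne_zero k)
        (sub_ne_zero.2 (hμ k (Nat.lt_succ_self k)))) hc, ?_⟩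
    have h1 : (LieModule.toEnd R L M e ^ (k + 1)) ((LieModule.toEnd R L M f ^ (k + 1)) m) =
        (LieModule.toEnd R L M e ^ k) ⁅e, (LieModule.toEnd R L M f ^ (k + 1)) m⁆ := by
      rw [pow_succ]; rfl
    rw [h1, P.lie_e_pow_succ_toEnd_f, map_smul, h, smul_smul]

namespace WeylType

variable {F : Type*} [Field F] {n : ℕ} {Γ : AddSubgroup (Fin n → F)}
  {V : Type*} [AddCommGroup V] [Module F V]
  [LieRingModule (WeylType Γ) V] [LieModule F (WeylType Γ) V]
  {U : Γ → Submodule F V} {N : ℕ}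

theorem IsBoundedFamily.toEnd_pow_mem (hU : IsBoundedFamily U N) (α : Γ)
    (p : MvPolynomial (Fin n) F) (k : ℕ) {β : Γ} {v : V} (hv : v ∈ U β) :
    (LieModule.toEnd F (WeylType Γ) V (single α p) ^ k) v ∈ U (k • α + β) := by
  induction k with
  | zero => simpa using hv
  | succ k ih =>
    rw [pow_succ', succ_nsmul', add_assoc]
    exact hU.lie_mem α _ p _ ih

/-- If `t^α` is locally nilpotent on a bounded family on which `D_j / α_j` has on `U_β` the single
generalized eigenvalue `β_j / α_j + c`, then the family vanishes far in direction `α`. -/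
theorem IsBoundedFamily.exists_eq_bot [CharZero F] (hU : IsBoundedFamily U N) {α : Γ}
    {j : Fin n} (hj : (α : Fin n → F) j ≠ 0) (c : F)
    (hnil : ∀ β, ∀ v ∈ U β, v ∈ (LieModule.toEnd F (WeylType Γ) V (t α)).maxGenEigenspace 0)
    (hwt : ∀ β, ∀ v ∈ U β,
      v ∈ (LieModule.toEnd F (WeylType Γ) V (single (0 : Γ) (height (α : Fin n → F) j))).maxGenEigenspace
        (((α : Fin n → F) j)⁻¹ * (β : Fin n → F) j + c)) (β : Γ) :
    ∃ k : ℕ, U (k • α + β) = ⊥ := by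
  classical
  by_contra! hne
  set e := LieModule.toEnd F (WeylType Γ) V (t α) with he
  set L := single (0 : Γ) (height (α : Fin n → F) j) with hL
  let s : F := ((α : Fin n → F) j)⁻¹ * (β : Fin n → F) j + c
  have hs : ∀ i : ℕ, ((α : Fin n → F) j)⁻¹ * ((i • α + β : Γ) : Fin n → F) j + c = s + i := by
    intro i
    simp only [s, AddSubgroup.coe_add, AddSubgroup.coe_nsmul, Pi.add_apply, Pi.smul_apply]
    rw [nsmul_eq_mul]
    field_simp
    ring
  have hLe : ⁅L, t α⁆ = t α := by
    rw [hL, t_eq_single, lie_height_single, inv_mul_cancel₀ hj, one_smul]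
  -- Highest weight vectors occur arbitrarily far along `α`: raise a nonzero vector by `t^α` to the
  -- last nonzero power, then apply `L` minus its generalized eigenvalue to the last nonzero power.
  -- The second operation preserves the kernel of `t^α`.
  have hexists : ∀ k : ℕ, ∃ i, k ≤ i ∧ ∃ u ∈ U (i • α + β), u ≠ 0 ∧ ⁅t α, u⁆ = 0 ∧
      ⁅L, u⁆ = (s + i) • u := by
    intro k
    obtain ⟨v, hv, hv0⟩ := (Submodule.ne_bot_iff _).1 (hne k)
    have h1 := (Module.End.mem_maxGenEigenspace _ _ _).1 (hnil _ v hv)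
    rw [zero_smul, sub_zero] at h1
    obtain ⟨m, hm, hm'⟩ : ∃ m, (e ^ m) v ≠ 0 ∧ (e ^ (m + 1)) v = 0 := by
      refine ⟨Nat.find h1 - 1, Nat.find_min h1 (Nat.sub_lt ?_ one_pos), ?_⟩
      · rw [Nat.find_pos]; exact hv0
      · rw [Nat.sub_add_cancel]
        · exact Nat.find_spec h1
        · rw [Nat.one_le_iff_ne_zero, ← Nat.pos_iff_ne_zero, Nat.find_pos]; exact hv0
    have hw : (e ^ m) v ∈ U ((m + k) • α + β) := by
      rw [add_nsmul, add_assoc]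
      exact hU.toEnd_pow_mem α 1 m hv
    have hew : ⁅t α, (e ^ m) v⁆ = 0 := by
      rw [pow_succ'] at hm'
      exact hm'
    let l : Module.End F V := LieModule.toEnd F (WeylType Γ) V L - (s + (m + k : ℕ)) • 1
    have hl : ∀ x : V, l x = ⁅L, x⁆ - (s + (m + k : ℕ)) • x := fun x => rfl
    have h2 := (Module.End.mem_maxGenEigenspace _ _ _).1 (hwt _ _ hw)
    rw [hs] at h2
    obtain ⟨r, hr⟩ := h2
    replace hr : (l ^ r) ((e ^ m) v) = 0 := hr
    refine ⟨m + k, Nat.le_add_left k m, ?_⟩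
    generalize (e ^ m) v = w at hm hw hew hr
    induction r generalizing w with
    | zero => exact absurd hr hm
    | succ r ih =>
      by_cases hlw : l w = 0
      · exact ⟨w, hw, hm, hew, sub_eq_zero.1 hlw⟩
      · refine ih (l w) hlw ?_ ?_ ?_
        · rw [hl]
          refine Submodule.sub_mem _ ?_ (Submodule.smul_mem _ _ hw)
          have := hU.lie_mem 0 _ (height (α : Fin n → F) j) w hw
          rwa [zero_add] at this
        · rw [hl, lie_sub, lie_smul, hew, smul_zero, sub_zero]
          have := leibniz_lie L (t α) w
          rw [hew, lie_zero, hLe, hew, zero_add] at this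
          exact this.symm
        · rw [← hr, pow_succ]; rfl
  -- For large `i` the highest weight `2(s + i)` is not one of `0, …, i - 1`, so lowering `i` times
  -- loses nothing. If `2s = -m`, a failure `2(s + i) = k < i` would force `i < m`.
  obtain ⟨m₀, hm₀⟩ : ∃ m₀ : ℕ, ∀ i ≥ m₀, ∀ k < i, 2 * (s + (i : F)) ≠ (k : F) := by
    by_cases h : ∃ m : ℕ, 2 * s = -(m : F)
    · obtain ⟨m, hm⟩ := h
      refine ⟨m, fun i hi k hk heq => ?_⟩
      have h1 : ((2 * i : ℕ) : F) = ((k + m : ℕ) : F) := by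
        push_cast
        linear_combination heq - hm
      have h2 := Nat.cast_injective h1
      omega
    · refine ⟨0, fun i _ k hk heq => h ⟨2 * i - k, ?_⟩⟩
      rw [Nat.cast_sub (by omega)]
      push_cast
      linear_combination heq
  let A : Set ℕ := {i | m₀ ≤ i ∧ ∃ u ∈ U (i • α + β), u ≠ 0 ∧ ⁅t α, u⁆ = 0 ∧
      ⁅L, u⁆ = (s + i) • u}
  have hA : A.Infinite := by
    refine Set.infinite_of_forall_exists_gt fun k => ?_
    obtain ⟨i, hi, hu⟩ := hexists (max m₀ (k + 1))
    exact ⟨i, ⟨(le_max_left _ _).trans hi, hu⟩, (le_max_right _ _).trans hi⟩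
  obtain ⟨T, hTA, hT⟩ := hA.exists_subset_card_eq (N + 1)
  choose u huU hu0 hue huL using fun i : T => (hTA i.2).2
  have sl2 := isSl2Triple_height α hj
  set f := single (-α) (height (α : Fin n → F) j - height (α : Fin n → F) j ^ 2) with hf
  have hP : ∀ i : T, sl2.HasPrimitiveVectorWith (u i) (2 * (s + ((i : ℕ) : F))) := fun i =>
    ⟨hu0 i, by rw [smul_lie, huL, smul_smul], hue i⟩
  choose d hd0 hd using fun i : T => (hP i).exists_e_pow_f_pow i (hm₀ i (hTA i.2).1)
  -- All the highest weight vectors are lowered into the single space `U β`; `N + 1` of them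
  -- contradict the bound `N`.
  let w : T → V := fun i => (LieModule.toEnd F (WeylType Γ) V f ^ (i : ℕ)) (u i)
  have hwU : ∀ i, w i ∈ U β := by
    intro i
    have := hU.toEnd_pow_mem (-α) (height (α : Fin n → F) j - height (α : Fin n → F) j ^ 2) i
      (huU i)
    rwa [smul_neg, neg_add_cancel_left] at this
  have hind : LinearIndependent F w := by
    refine linearIndependent_of_pow_apply_eq_zero e T w (fun i => ?_) fun i => ?_
    · rw [hd i]
      exact smul_ne_zero (hd0 i) (hu0 i)
    · rw [pow_succ', Module.End.mul_apply, hd i, map_smul]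
      exact (congrArg _ (hue i)).trans (smul_zero _)
  have hind' : LinearIndependent F fun i => (⟨w i, hwU i⟩ : U β) :=
    LinearIndependent.of_comp (U β).subtype hind
  have := hU.finiteDimensional β
  have hcard := hind'.fintype_card_le_finrank
  rw [Fintype.card_coe, hT] at hcard
  exact absurd (hcard.trans (hU.finrank_le β)) (by omega)

end WeylType

/-! ### Trivial action and trivial composition factors -/

namespace WeylType

variable {F : Type*} [Field F] {n : ℕ} {Γ : AddSubgroup (Fin n → F)}
  {V : Type*} [AddCommGroup V] [Module F V]
  [LieRingModule (WeylType Γ) V] [LieModule F (WeylType Γ) V]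
  {U : Γ → Submodule F V} {N : ℕ}

/-- If a bounded family vanishes far in direction `α`, then the annihilators of its members have no
common zeros: a common zero would propagate to arbitrarily many ones in a single degree. -/
theorem IsBoundedFamily.annihilatorZeros_eq_empty [CharZero F]
    (hU : IsBoundedFamily U N) {α : Γ} {j : Fin n} (hj : (α : Fin n → F) j ≠ 0)
    (hbot : ∀ β, ∃ k : ℕ, U (k • α + β) = ⊥) (ν β : Γ) :
    annihilatorZeros U ν β = ∅ := by
  refine Set.eq_empty_iff_forall_notMem.2 fun x hx => ?_
  have hinj : ∀ k m : ℕ, k • α = m • α → k = m := by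
    intro k m h
    have h1 := congrFun (congrArg Subtype.val h) j
    simp only [AddSubgroup.coe_nsmul, Pi.smul_apply] at h1
    rw [nsmul_eq_mul, nsmul_eq_mul] at h1
    exact Nat.cast_injective (mul_right_cancel₀ hj h1)
  -- The propagation lemma needs a nonzero operator degree; `k • α + ν` vanishes for at most one
  -- `k`.
  obtain ⟨K, hK⟩ : ∃ K : ℕ, ∀ k ≥ K, k • α + ν ≠ 0 := by
    by_cases h : ∃ m : ℕ, m • α + ν = 0
    · obtain ⟨m, hm⟩ := h
      refine ⟨m + 1, fun k hk h0 => ?_⟩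
      have := hinj k m (add_right_cancel (h0.trans hm.symm))
      omega
    · exact ⟨0, fun k _ h0 => h ⟨k, h0⟩⟩
  obtain ⟨k, hk0, hkK, hk⟩ : ∃ k : ℕ, 0 < k ∧ K ≤ k ∧ U (k • α + (ν + β)) = ⊥ := by
    obtain ⟨k, hk⟩ := hbot ((K + 1) • α + (ν + β))
    refine ⟨k + (K + 1), by omega, by omega, ?_⟩
    rwa [add_nsmul, add_assoc]
  -- Each step moves `k • α` from the module degree to the operator degree, keeps the old zeros and
  -- adds their translates by `-k • α`. The next operator degree plus the current module degree is
  -- always `k • α + (ν + β)`, so the same `k` serves every step.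
  have key : ∀ i : ℕ, ∀ m ≤ i, x - ((m * k) • α : Γ) ∈
      annihilatorZeros U ((i * k) • α + ν) (β - (i * k) • α) := by
    intro i
    induction i with
    | zero =>
      intro m hm
      obtain rfl : m = 0 := by omega
      simpa using hx
    | succ i ih =>
      have hne : ((i + 1) * k) • α + ν ≠ 0 :=
        hK _ (hkK.trans (Nat.le_mul_of_pos_left k (Nat.succ_pos i)))
      have hdeg : U (((i + 1) * k) • α + ν + (β - (i * k) • α)) = ⊥ := by
        rw [← hk]
        congr 1
        rw [add_mul, one_mul, add_nsmul]
        abel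
      have h1 : ((i + 1) * k) • α + ν + -(k • α) = (i * k) • α + ν := by
        rw [add_mul, one_mul, add_nsmul]
        abel
      have h2 : -(k • α) + (β - (i * k) • α) = β - ((i + 1) * k) • α := by
        rw [add_mul, one_mul, add_nsmul]
        abel
      have step : ∀ y ∈ annihilatorZeros U ((i * k) • α + ν) (β - (i * k) • α),
          y ∈ annihilatorZeros U (((i + 1) * k) • α + ν) (β - ((i + 1) * k) • α) ∧
          y + ((-(k • α) : Γ) : Fin n → F) ∈
            annihilatorZeros U (((i + 1) * k) • α + ν) (β - ((i + 1) * k) • α) := by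
        intro y hy
        rw [← h1] at hy
        have := hU.mem_annihilatorZeros (-(k • α)) hne hdeg hy
        rwa [h2] at this
      intro m hm
      rcases Nat.lt_or_ge i m with h | h
      · obtain rfl : m = i + 1 := by omega
        have := (step _ (ih i le_rfl)).2
        rw [add_mul, one_mul, add_nsmul, AddSubgroup.coe_add]
        rw [AddSubgroup.coe_neg, ← sub_eq_add_neg, sub_sub] at this
        rwa [add_mul, one_mul, add_nsmul] at this
      · exact (step _ (ih m h)).1
  refine hU.not_injective_of_annihilatorZeros
    (fun m : Fin (N * N + 1) => x - (((m : ℕ) * k) • α : Γ))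
    (fun m => key (N * N) m (Nat.lt_succ_iff.1 m.2)) j ?_
  intro a b hab
  simp only [AddSubgroup.coe_nsmul, Pi.sub_apply, Pi.smul_apply, sub_right_inj] at hab
  rw [nsmul_eq_mul, nsmul_eq_mul] at hab
  have h1 := Nat.cast_injective (mul_right_cancel₀ hj hab)
  exact Fin.ext (Nat.eq_of_mul_eq_mul_right hk0 h1)

/-- Nonzero degrees act by zero by the Nullstellensatz. Degree `0` follows because, differences
being surjective, each of its elements is a bracket of `t^α` with an element of degree `-α`. -/
theorem IsBoundedFamily.lie_eq_zero [IsAlgClosed F] [CharZero F]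
    (hU : IsBoundedFamily U N) {α : Γ} {j : Fin n} (hj : (α : Fin n → F) j ≠ 0)
    (hbot : ∀ β, ∃ k : ℕ, U (k • α + β) = ⊥) (x : WeylType Γ) {β : Γ} {v : V} (hv : v ∈ U β) :
    ⁅x, v⁆ = 0 := by
  have hα : α ≠ 0 := by
    rintro rfl
    exact hj rfl
  have h1 : ∀ ν : Γ, ν ≠ 0 → ∀ p, ⁅single ν p, v⁆ = 0 := by
    intro ν hν p
    have h := hU.annihilator_eq_top hν (hU.annihilatorZeros_eq_empty hj hbot ν β)
    exact mem_annihilator.1 (h ▸ Submodule.mem_top : p ∈ annihilator U ν β) v hv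
  induction x using WeylType.induction with
  | h0 => exact zero_lie v
  | ha f g hf hg => rw [add_lie, hf, hg, add_zero]
  | hs ν p =>
    by_cases hν : ν = 0
    · obtain ⟨q, rfl⟩ := diff_surjective (β := (α : Fin n → F)) (by simpa using hα) p
      have h2 : single ν (diff (α : Fin n → F) q) = ⁅t α, single (-α) (-q)⁆ := by
        rw [lie_t_single, map_neg, neg_neg, add_neg_cancel, hν]
      rw [h2, lie_lie, h1 (-α) (neg_ne_zero.2 hα), t_eq_single, h1 α hα, lie_zero, lie_zero,
        sub_zero]
    · exact h1 ν hν p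

/-- The part of a uniformly bounded module on which `t^α` is locally nilpotent and `D_j / α_j` has
the generalized eigenvalue `β_j / α_j + c` in degree `β`. -/
theorem isBoundedFamily_inf {𝒱 : Γ → Submodule F V} (h : IsQuasifinite 𝒱)
    (hN : ∀ β, Module.finrank F (𝒱 β) ≤ N) (α : Γ) (j : Fin n) (c : F) :
    IsBoundedFamily (fun β => 𝒱 β ⊓
      ((LieModule.toEnd F (WeylType Γ) V (t α)).maxGenEigenspace 0 ⊓
      (LieModule.toEnd F (WeylType Γ) V
        (single (0 : Γ) (height (α : Fin n → F) j))).maxGenEigenspace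
        (((α : Fin n → F) j)⁻¹ * (β : Fin n → F) j + c))) N where
  lie_mem γ β p v hv := by
    refine ⟨h.lie_mem γ β _ (single_mem_gradingSpace γ p) v hv.1, ?_, ?_⟩
    · have := LieModule.lie_mem_maxGenEigenspace_toEnd (mem_maxGenEigenspace_t α (single γ p))
        hv.2.1
      rwa [add_zero] at this
    · have h1 : single γ p ∈ (LieModule.toEnd F (WeylType Γ) (WeylType Γ)
          (single (0 : Γ) (height (α : Fin n → F) j))).maxGenEigenspace
          (((α : Fin n → F) j)⁻¹ * (γ : Fin n → F) j) := by
        rw [Module.End.mem_maxGenEigenspace]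
        refine ⟨1, ?_⟩
        rw [pow_one]
        exact sub_eq_zero.2 (lie_height_single α γ j p)
      have := LieModule.lie_mem_maxGenEigenspace_toEnd h1 hv.2.2
      rwa [← add_assoc, ← mul_add] at this
  finiteDimensional β := by
    have := h.finiteDimensional β
    exact Submodule.finiteDimensional_inf_left _ _
  finrank_le β := by
    have := h.finiteDimensional β
    exact (Submodule.finrank_mono inf_le_left).trans (hN β)

/-- The line spanned by an invariant vector, as a submodule. -/
def lineOfInvariant (v : V) (hv : ∀ x : WeylType Γ, ⁅x, v⁆ = 0) :
    LieSubmodule F (WeylType Γ) V where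
  __ := Submodule.span F {v}
  lie_mem {x m} hm := by
    obtain ⟨c, rfl⟩ := Submodule.mem_span_singleton.1 hm
    rw [lie_smul, hv, smul_zero]
    exact Submodule.zero_mem _

theorem hasTrivialCompositionFactor_of_invariant {𝒱 : Γ → Submodule F V} {β : Γ} {v : V}
    (hvβ : v ∈ 𝒱 β) (hv0 : v ≠ 0) (hv : ∀ x : WeylType Γ, ⁅x, v⁆ = 0) :
    HasTrivialCompositionFactor 𝒱 := by
  set M := lineOfInvariant v hv with hM
  have hMs : M.toSubmodule = Submodule.span F {v} := rfl
  have hmem : ∀ m : M, ∃ c : F, c • v = m := fun m => Submodule.mem_span_singleton.1 m.2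
  have hvM : v ∈ M := Submodule.mem_span_singleton_self v
  refine ⟨⊥, M, bot_le, ?_, ?_, ?_, ?_⟩
  · simp [IsGradedSubmodule]
  · refine le_antisymm ?_ (iSup_le fun _ => inf_le_left)
    rw [hMs, Submodule.span_singleton_le_iff_mem]
    exact Submodule.mem_iSup_of_mem β ⟨Submodule.mem_span_singleton_self v, hvβ⟩
  · set q := LieSubmodule.Quotient.mk' ((⊥ : LieSubmodule F (WeylType Γ) V).comap M.incl) with hq
    have hq0 : ∀ m : M, q m = 0 ↔ m = 0 := by
      intro m
      rw [LieSubmodule.Quotient.mk_eq_zero]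
      simp
    have hsurj : Function.Surjective q := LieSubmodule.Quotient.surjective_mk' _
    have : Nontrivial (M ⧸ (⊥ : LieSubmodule F (WeylType Γ) V).comap M.incl) :=
      ⟨⟨q ⟨v, hvM⟩, 0, fun h => hv0 (congrArg Subtype.val ((hq0 _).1 h))⟩⟩
    refine LieModule.IsIrreducible.mk fun P hP => ?_
    obtain ⟨y, hyP, hy0⟩ : ∃ y ∈ P, y ≠ 0 := by
      by_contra! h
      exact hP ((LieSubmodule.eq_bot_iff P).2 h)
    rw [eq_top_iff]
    intro z _
    obtain ⟨y, rfl⟩ := hsurj y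
    obtain ⟨z, rfl⟩ := hsurj z
    obtain ⟨a, ha⟩ := hmem y
    obtain ⟨b, hb⟩ := hmem z
    have ha0 : a ≠ 0 := by
      rintro rfl
      refine hy0 ((hq0 y).2 (Subtype.ext ?_))
      rw [← ha, zero_smul]
      rfl
    have hz : z = (b * a⁻¹) • y := by
      refine Subtype.ext ?_
      rw [← hb]
      change b • v = (b * a⁻¹) • (y : V)
      rw [← ha, smul_smul, mul_assoc, inv_mul_cancel₀ ha0, mul_one]
    rw [hz, map_smul]
    exact P.smul_mem _ hyP
  · refine ⟨fun x z => ?_⟩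
    obtain ⟨z, rfl⟩ := LieSubmodule.Quotient.surjective_mk' _ z
    obtain ⟨b, hb⟩ := hmem z
    have h0 : ⁅x, z⁆ = 0 := by
      refine Subtype.ext ?_
      change ⁅x, (z : V)⁆ = 0
      rw [← hb, lie_smul, hv, smul_zero]
    rw [← LieModuleHom.map_lie, h0, map_zero]

theorem lie_t_ne_zero_of_mem [IsAlgClosed F] [CharZero F] {𝒱 : Γ → Submodule F V}
    (hV : IsUniformlyBounded 𝒱) (htriv : ¬ HasTrivialCompositionFactor 𝒱) {α : Γ} (hα : α ≠ 0)
    {β : Γ} {v : V} (hvβ : v ∈ 𝒱 β) (hv0 : v ≠ 0) : ⁅t α, v⁆ ≠ 0 := by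
  intro htv
  obtain ⟨N, -, hN⟩ := hV.bounded
  obtain ⟨j, hj⟩ := Function.ne_iff.1 (show (α : Fin n → F) ≠ 0 by simpa using hα)
  replace hj : (α : Fin n → F) j ≠ 0 := hj
  set L := LieModule.toEnd F (WeylType Γ) V (single (0 : Γ) (height (α : Fin n → F) j)) with hL
  -- A finite-dimensional nonzero space stable under `L`; algebraic closedness supplies an
  -- eigenvector in it.
  let K : Submodule F V := 𝒱 β ⊓ LinearMap.ker (LieModule.toEnd F (WeylType Γ) V (t α))
  have hLK : ∀ w ∈ K, L w ∈ K := by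
    intro w hw
    refine ⟨?_, ?_⟩
    · have := hV.lie_mem 0 β _ (single_mem_gradingSpace 0 (height (α : Fin n → F) j)) w hw.1
      rwa [zero_add] at this
    · have h0 : ⁅t α, w⁆ = 0 := hw.2
      have h1 := leibniz_lie (single (0 : Γ) (height (α : Fin n → F) j)) (t α) w
      rw [h0, lie_zero, t_eq_single, lie_height_single, inv_mul_cancel₀ hj, one_smul,
        ← t_eq_single, h0, zero_add] at h1
      exact h1.symm
  have := hV.finiteDimensional β
  have : FiniteDimensional F K := Submodule.finiteDimensional_inf_left _ _
  have : Nontrivial K := ⟨⟨⟨v, hvβ, htv⟩, 0, fun h => hv0 (congrArg Subtype.val h)⟩⟩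
  obtain ⟨l, hl⟩ := Module.End.exists_eigenvalue (L.restrict hLK)
  obtain ⟨u, hu⟩ := hl.exists_hasEigenvector
  have hu0 : (u : V) ≠ 0 := fun h => hu.2 (Subtype.ext h)
  have huL : L (u : V) = l • (u : V) := congrArg Subtype.val hu.apply_eq_smul
  -- The constant is chosen so that the prescribed eigenvalue in degree `β` is `l`, which puts `u`
  -- in the family.
  have hU := isBoundedFamily_inf hV.toIsQuasifinite hN α j
    (l - ((α : Fin n → F) j)⁻¹ * (β : Fin n → F) j)
  refine htriv (hasTrivialCompositionFactor_of_invariant u.2.1 hu0 fun x =>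
    hU.lie_eq_zero hj (hU.exists_eq_bot hj _ (fun γ w hw => hw.2.1) fun γ w hw => hw.2.2) x
      (β := β) ⟨u.2.1, ?_, ?_⟩)
  · rw [SetLike.mem_coe, Module.End.mem_maxGenEigenspace]
    exact ⟨1, by rw [pow_one, zero_smul, sub_zero]; exact u.2.2⟩
  · rw [SetLike.mem_coe, Module.End.mem_maxGenEigenspace, add_sub_cancel]
    exact ⟨1, by rw [pow_one]; exact sub_eq_zero.2 huL⟩

end WeylType

/-! ### From homogeneous to arbitrary vectors -/

/-- An operator that is homogeneous of degree `α` and injective on each grading space is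
injective. -/
theorem DirectSum.IsInternal.ne_zero_of_homogeneous {ι F V : Type*} [DecidableEq ι]
    [AddCancelCommMonoid ι] [Field F] [AddCommGroup V] [Module F V] {𝒱 : ι → Submodule F V}
    (h : DirectSum.IsInternal 𝒱) (T : Module.End F V) (α : ι)
    (hT : ∀ β, ∀ v ∈ 𝒱 β, T v ∈ 𝒱 (α + β)) (hne : ∀ β, ∀ v ∈ 𝒱 β, v ≠ 0 → T v ≠ 0)
    {v : V} (hv : v ≠ 0) : T v ≠ 0 := by
  intro hTv
  -- Translation by `α` is injective, so the images of distinct components lie in independent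
  -- subspaces and must vanish separately.
  have hind : iSupIndep fun β => 𝒱 (α + β) :=
    h.submodule_iSupIndep.comp (add_right_injective α)
  obtain ⟨f, rfl⟩ := h.surjective v
  let g : Π₀ β, 𝒱 (α + β) := DFinsupp.mapRange.linearMap (fun β => T.restrict (hT β)) f
  have hcomp : (DFinsupp.lsum ℕ fun β => (𝒱 (α + β)).subtype) ∘ₗ
      DFinsupp.mapRange.linearMap (fun β => T.restrict (hT β)) =
      T ∘ₗ DirectSum.coeLinearMap 𝒱 := by
    refine DFinsupp.lhom_ext fun β w => ?_
    rw [LinearMap.comp_apply, LinearMap.comp_apply, DFinsupp.mapRange.linearMap_apply,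
      DFinsupp.mapRange_single]
    refine (DFinsupp.lsum_single ℕ _ _ _).trans ?_
    exact congrArg T (DirectSum.coeLinearMap_of 𝒱 β w).symm
  have hg : g = 0 := by
    refine hind.dfinsupp_lsum_injective ?_
    rw [map_zero]
    exact (LinearMap.congr_fun hcomp f).trans hTv
  refine hv ?_
  have hf : f = 0 := by
    refine DFinsupp.ext fun β => ?_
    by_contra hβ
    refine hne β (f β) (f β).2 (fun h0 => hβ (Subtype.ext h0)) ?_
    exact congrArg Subtype.val (DFunLike.congr_fun hg β)
  rw [hf, map_zero]

end

theorem proposition3p2 {F : Type*} [Field F] [IsAlgClosed F] [CharZero F]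
    (n : ℕ) (hn : 0 < n) (Γ : AddSubgroup (Fin n → F))
    (hΓ : Submodule.span F (Γ : Set (Fin n → F)) = ⊤)
    (hΓZ : IsEmpty (Γ ≃+ ℤ))
    {V : Type*} [AddCommGroup V] [Module F V]
    [LieRingModule (WeylType Γ) V] [LieModule F (WeylType Γ) V]
    (𝒱 : Γ → Submodule F V) (hV : IsUniformlyBounded 𝒱)
    (htriv : ¬ HasTrivialCompositionFactor 𝒱) :
    ∀ α : Γ, α ≠ 0 → ∀ v : V, v ≠ 0 → ⁅WeylType.t α, v⁆ ≠ 0 := by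
  classical
  intro α hα v hv
  exact hV.isInternal.ne_zero_of_homogeneous
    (LieModule.toEnd F (WeylType Γ) V (WeylType.t α)) α
    (fun β w hw => hV.lie_mem α β _ (WeylType.single_mem_gradingSpace α 1) w hw)
    (fun β w hw hw0 => WeylType.lie_t_ne_zero_of_mem hV htriv hα hw hw0) hv
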